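/- Consider linear equations $E:\ \sum_{i=1}^k a_i x_i=0$ with integer coefficients. Say that $E$ has genus one if $\sum_{i=1}^k a_i=0$ but $\sum_{i\in T}a_i\neq 0$ for every $\varnothing\subsetneq T\subsetneq\{1,\dots,k\}$. A non-trivial solution of $E$ is a tuple of integers $y_1,\dots,y_k$, not all equal, with $\sum_i a_iy_i=0$, and $r_E(m)$ is the maximum size of a subset of $\{1,\dots,m\}$ containing no non-trivial solution of $E$. Ruzsa's genus conjecture (for genus one) says that for every equation $E$ of genus one, $r_E(m)\ge m^{1-o(1)}$ as $m\to\infty$. An $n$-vertex graph is $\varepsilon$-far from triangle-free if it cannot be made triangle-free by deleting fewer than $\varepsilon n^2$ edges. A copy of a finite graph $H$ in $G$ is a subgraph of $G$ isomorphic to $H$. A finite graph $H$ is $K_3$-abundant if there is $C_H>0$ such that for every $0<\varepsilon\le\frac12$, every sufficiently large $n$ (in terms of $\varepsilon$ and $H$), and every $n$-vertex graph $G$ that is $\varepsilon$-far from triangle-free, $G$ contains at least $\varepsilon^{C_H}n^{|V(H)|}$ copies of $H$. **Theorem.** Assume that Ruzsa's genus conjecture (for genus one) holds. Then there exists a finite,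 triangle-free, tripartite (i.e. properly $3$-colorable) graph $H$ which is not $K_3$-abundant. Moreover, for this $H$, there are graphs $\varepsilon$-far from triangle-free with only $\varepsilon^{\omega(1)}n^{|V(H)|}$ copies of $H$, in the following sense: for every real $C$ there is $\varepsilon_0>0$ such that for every $0<\varepsilon<\varepsilon_0$ and every sufficiently large $n$ (in terms of $\varepsilon$, $C$ and $H$) there is an $n$-vertex graph $G$ which is $\varepsilon$-far from triangle-free and contains at most $\varepsilon^{C}n^{|V(H)|}$ copies of $H$. -/

import Mathlib

open Filter

/-- The linear equation `∑ i, a i * x i = 0` with integer coefficients has genus one: its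
coefficients sum to zero, but no nonempty proper subset of them does. -/
def IsGenusOne {k : ℕ} (a : Fin k → ℤ) : Prop :=
  ∑ i, a i = 0 ∧ ∀ T : Finset (Fin k), T ≠ ∅ → T ≠ Finset.univ → ∑ i ∈ T, a i ≠ 0

/-- A non-trivial solution of `∑ i, a i * x i = 0`: a solution whose entries are not all equal. -/
def IsNontrivialSolution {k : ℕ} (a y : Fin k → ℤ) : Prop :=
  ∑ i, a i * y i = 0 ∧ ¬ ∀ i j, y i = y j

/-- `R` contains no non-trivial solution of `∑ i, a i * x i = 0`. Repeated entries are allowed. -/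
def AvoidsEquation {k : ℕ} (a : Fin k → ℤ) (R : Finset ℤ) : Prop :=
  ∀ y : Fin k → ℤ, (∀ i, y i ∈ R) → ¬ IsNontrivialSolution a y

open Classical in
/-- `r_E(m)` for the equation `E : ∑ i, a i * x i = 0`: the maximum size of a subset of
`[m] = {1, …, m}` containing no non-trivial solution of `E`. -/
noncomputable def maxAvoiding {k : ℕ} (a : Fin k → ℤ) (m : ℕ) : ℕ :=
  ((Finset.Icc (1 : ℤ) (m : ℤ)).powerset.filter (fun R => AvoidsEquation a R)).sup Finset.card

/-- Ruzsa's genus conjecture, for equations of genus one: `r_E(m) ≥ m ^ (1 - o(1))`. The `o(1)`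
may depend on the equation `E`. -/
def RuzsaGenusConjecture : Prop :=
  ∀ (k : ℕ) (a : Fin k → ℤ), IsGenusOne a →
    ∀ η : ℝ, 0 < η → ∀ᶠ m : ℕ in atTop, (m : ℝ) ^ (1 - η) ≤ (maxAvoiding a m : ℝ)

open Classical in
/-- `H` is `K₃`-abundant: for some `C > 0` and all `0 < ε ≤ 1/2`, every graph `G` on `n` vertices,
`n` sufficiently large in terms of `ε`, that is `ε`-far from triangle-free (it cannot be made
triangle-free by deleting fewer than `ε * n ^ 2` edges) contains at least `ε ^ C * n ^ |V(H)|`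
copies of `H`, that is, subgraphs isomorphic to `H`. Without `n` being large, no graph on four or
more vertices would qualify, as a triangle contains no copy of it. -/
def IsK3Abundant {V : Type*} [Fintype V] (H : SimpleGraph V) : Prop :=
  ∃ C : ℝ, 0 < C ∧ ∀ ε : ℝ, 0 < ε → ε ≤ 1 / 2 →
    ∃ n₀ : ℕ, ∀ n : ℕ, n₀ ≤ n → ∀ G : SimpleGraph (Fin n), G.FarFromTriangleFree ε →
      ε ^ C * (n : ℝ) ^ Fintype.card V ≤ (G.copyCount H : ℝ)

open Classical in
/-- For all small `ε > 0` and all `n` sufficiently large in terms of `ε`, some graph on `n`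
vertices is `ε`-far from triangle-free but has at most `ε ^ ω(1) * n ^ |V(H)|` copies of `H`, where
`ω(1)` tends to infinity as `ε → 0`. The last clause is unfolded: for each fixed exponent `C`,
the bound `ε ^ C * n ^ |V(H)|` holds once `ε` is small enough. -/
def HasSuperpolynomiallyFewCopies {V : Type*} [Fintype V] (H : SimpleGraph V) : Prop :=
  ∀ C : ℝ, ∃ ε₀ : ℝ, 0 < ε₀ ∧ ∀ ε : ℝ, 0 < ε → ε < ε₀ →
    ∃ n₀ : ℕ, ∀ n : ℕ, n₀ ≤ n → ∃ G : SimpleGraph (Fin n), G.FarFromTriangleFree ε ∧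
      (G.copyCount H : ℝ) ≤ ε ^ C * (n : ℝ) ^ Fintype.card V

/-! The witness is `circulant27`. The host graph is a blow-up of a Ruzsa–Szemerédi graph: three
colour classes, with triangles at positions `x`, `x + r`, `x + 2r` for labels `r ∈ R ⊆ [m]`. It
contains many edge-disjoint triangles as soon as `R` is dense.

In a copy of `H`, properly coloured by `φ`, every edge `e` has a label `r e`, and its position
increment is `cornerStep` times `r e`. Pairing with an integral flow `f` gives `∑ f e * cornerStep *
r e = 0`. If this equation has genus one and `R` avoids it, all labels of the copy agree, so two
adjacent vertices fix all positions. Only about `n ^ h / m` copies then remain, where `h = |V(H)|`.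
Ruzsa's conjecture permits `|R| ≥ m ^ (1 - η)` for any `η > 0`, so `m` can be a large power of `1 /
ε`.

A generic flow gives genus one unless, for some proper nonempty edge set `T`, the vector equal to
`cornerStep` on `T` and to `0` elsewhere is the coboundary of a potential `p`. Modulo 3, `p` and `p
- φ` would then be the coordinates of a homomorphism to the rook's graph using both directions.
`RookRigid` excludes this (`RookRigid.potential_increments`, `RookRigid.exists_flow`); for
`circulant27` it is a finite search. -/

/-! ### Walks on the rook's graph -/

/-- Two cells of the `3 × 3` board in a common row or column, but not both. -/
def RookMove (x y : ZMod 3 × ZMod 3) : Prop :=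
  (x.1 = y.1 ∧ x.2 ≠ y.2) ∨ (x.1 ≠ y.1 ∧ x.2 = y.2)

/-- Every homomorphism from `H` to the `3 × 3` rook's graph has its image in a single row or a
single column. -/
def RookRigid {V : Type*} (H : SimpleGraph V) : Prop :=
  ∀ h : V → ZMod 3 × ZMod 3, (∀ u v, H.Adj u v → RookMove (h u) (h v)) →
    (∀ u v, (h u).1 = (h v).1) ∨ (∀ u v, (h u).2 = (h v).2)

/-- The rook's graph with the cell `(x, y)` encoded as `3 * x + y`. -/
def rookMoveCode (x y : ℕ) : Bool :=
  ((x / 3).beq (y / 3) && !(x % 3).beq (y % 3)) || (!(x / 3).beq (y / 3) && (x % 3).beq (y % 3))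

/-- `y` can precede the partial sequence `l`, listed backwards, of cells such that any two at
distance `1`, `5` or `8` are a rook's move apart. -/
def rookExtends (l : List ℕ) (y : ℕ) : Bool :=
  rookMoveCode (l.getD 0 9) y && (l.length.blt 5 || rookMoveCode (l.getD 4 9) y) &&
    (l.length.blt 8 || rookMoveCode (l.getD 7 9) y)

/-- Depth-first search showing that the partial sequence `l` cannot be prolonged by `k` terms. -/
def rookDeadEnd : ℕ → List ℕ → Bool
  | 0, _ => false
  | k + 1, l => (List.range 9).all fun y => !rookExtends l y || rookDeadEnd k (y :: l)

/-- Soundness of the search: the next term of an actual sequence always survives the test. -/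
theorem not_rookDeadEnd {c : ℕ → ℕ} (hc : ∀ i, c i < 9)
    (h : ∀ i, rookMoveCode (c i) (c (i + 1)) ∧ rookMoveCode (c i) (c (i + 5)) ∧
      rookMoveCode (c i) (c (i + 8))) (k m : ℕ) :
    rookDeadEnd k (((List.range (m + 1)).map c).reverse) = false := by
  induction k generalizing m with
  | zero => rfl
  | succ k ih =>
    have hlist : ((List.range (m + 2)).map c).reverse
        = c (m + 1) :: ((List.range (m + 1)).map c).reverse := by
      rw [List.range_succ]; simp
    have hget : ∀ j, j ≤ m → (((List.range (m + 1)).map c).reverse).getD j 9 = c (m - j) := by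
      intro j hj
      rw [List.getD_eq_getElem _ _ (by simp; omega)]
      simp
    have hext : rookExtends (((List.range (m + 1)).map c).reverse) (c (m + 1)) = true := by
      unfold rookExtends
      simp only [List.length_reverse, List.length_map, List.length_range, Bool.and_eq_true,
        Bool.or_eq_true, Nat.blt_eq]
      refine ⟨⟨?_, ?_⟩, ?_⟩
      · rw [hget 0 (by omega)]; exact (h m).1
      · by_cases hm : m + 1 < 5
        · exact .inl hm
        · rw [hget 4 (by omega)]
          have := (h (m - 4)).2.1
          rw [show m - 4 + 5 = m + 1 by omega] at this
          exact .inr this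
      · by_cases hm : m + 1 < 8
        · exact .inl hm
        · rw [hget 7 (by omega)]
          have := (h (m - 7)).2.2
          rw [show m - 7 + 8 = m + 1 by omega] at this
          exact .inr this
    rw [rookDeadEnd, List.all_eq_false]
    refine ⟨c (m + 1), List.mem_range.2 (hc _), ?_⟩
    rw [hext, ← hlist, ih (m + 1)]
    decide

/-- These are the turns from a row into a column, translated to start at the cell `0`; none can be
prolonged by ten terms. -/
theorem rookDeadEnd_turn : ∀ x ∈ [1, 2], ∀ y ∈ [3, 6], rookDeadEnd 10 [y + x, x, 0] = true := by
  decide +kernel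

theorem rookMoveCode_iff : ∀ x y : ZMod 3 × ZMod 3, RookMove x y →
    rookMoveCode (3 * x.1.val + x.2.val) (3 * y.1.val + y.2.val) = true := by
  unfold RookMove
  decide

theorem RookMove.sub_right {x y : ZMod 3 × ZMod 3} (h : RookMove x y) (z : ZMod 3 × ZMod 3) :
    RookMove (x - z) (y - z) := by
  simpa [RookMove] using h

theorem RookMove.swap {x y : ZMod 3 × ZMod 3} (h : RookMove x y) : RookMove x.swap y.swap := by
  unfold RookMove at *
  simp only [Prod.fst_swap, Prod.snd_swap]
  tauto

theorem rookTurn_cases : ∀ y z : ZMod 3 × ZMod 3, RookMove 0 y → RookMove y z → 0 = y.1 →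
    y.1 ≠ z.1 → ∃ s ∈ [1, 2], ∃ t ∈ [3, 6],
      3 * y.1.val + y.2.val = s ∧ 3 * z.1.val + z.2.val = t + s := by
  unfold RookMove
  decide

/-- A sequence of cells, any two at distance `1`, `5` or `8` being a rook's move apart, does not
turn. -/
theorem fst_eq_of_rookMove {a : ℕ → ZMod 3 × ZMod 3}
    (h : ∀ i, RookMove (a i) (a (i + 1)) ∧ RookMove (a i) (a (i + 5)) ∧
      RookMove (a i) (a (i + 8))) (h₀ : (a 0).1 = (a 1).1) : (a 1).1 = (a 2).1 := by
  by_contra hne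
  set b : ℕ → ZMod 3 × ZMod 3 := fun i => a i - a 0 with hb
  have hb₀ : b 0 = 0 := sub_self _
  have hbm : ∀ i, RookMove (b i) (b (i + 1)) ∧ RookMove (b i) (b (i + 5)) ∧
      RookMove (b i) (b (i + 8)) := fun i =>
    ⟨(h i).1.sub_right _, (h i).2.1.sub_right _, (h i).2.2.sub_right _⟩
  obtain ⟨s, hs, t, ht, hy, hz⟩ := rookTurn_cases (b 1) (b 2) (hb₀ ▸ (hbm 0).1) (hbm 1).1
    (by simp [hb, h₀]) (by simpa [hb] using hne)
  have hdead := rookDeadEnd_turn s hs t ht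
  have hlive := not_rookDeadEnd (c := fun i => 3 * (b i).1.val + (b i).2.val)
    (fun i => by have := (b i).1.val_lt; have := (b i).2.val_lt; omega)
    (fun i => ⟨rookMoveCode_iff _ _ (hbm i).1, rookMoveCode_iff _ _ (hbm i).2.1,
      rookMoveCode_iff _ _ (hbm i).2.2⟩) 10 2
  have hl : ((List.range (2 + 1)).map fun i => 3 * (b i).1.val + (b i).2.val).reverse
      = [t + s, s, 0] := by
    simp [List.range_succ, hy, hz, hb₀]
  rw [hl, hdead] at hlive
  exact absurd hlive (by decide)

/-! ### The circulant graph -/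

/-- The circulant graph on `ℤ / 27` with differences `±1`, `±5`, `±8`. -/
def circulant27 : SimpleGraph (Fin 27) :=
  SimpleGraph.fromRel fun u v => v - u = 1 ∨ v - u = 5 ∨ v - u = 8

theorem circulant27_adj {u v : Fin 27} : circulant27.Adj u v ↔
    (v - u = 1 ∨ v - u = 5 ∨ v - u = 8) ∨ (u - v = 1 ∨ u - v = 5 ∨ u - v = 8) := by
  rw [circulant27, SimpleGraph.fromRel_adj, and_iff_right_iff_imp]
  rintro h rfl
  simp at h

theorem circulant27_adj_add (u : Fin 27) : circulant27.Adj u (u + 1) ∧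
    circulant27.Adj u (u + 5) ∧ circulant27.Adj u (u + 8) := by
  simp [circulant27_adj]

/-- Up to sign the differences are `1, -5, -8`, all congruent to `1` mod 3. Three signed ones
summing to zero must share a sign, but sums of three from this list lie in `[-24, 3]` and are never
`0`. -/
theorem circulant27_cliqueFree : circulant27.CliqueFree 3 := by
  have key : ∀ x y : Fin 27, (x = 1 ∨ x = 5 ∨ x = 8) ∨ (-x = 1 ∨ -x = 5 ∨ -x = 8) →
      (y = 1 ∨ y = 5 ∨ y = 8) ∨ (-y = 1 ∨ -y = 5 ∨ -y = 8) →
      ¬ ((x + y = 1 ∨ x + y = 5 ∨ x + y = 8) ∨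
        (-(x + y) = 1 ∨ -(x + y) = 5 ∨ -(x + y) = 8)) := by
    decide +kernel
  intro s hs
  obtain ⟨a, b, c, hab, hac, hbc, -⟩ := SimpleGraph.is3Clique_iff.1 hs
  rw [circulant27_adj] at hab hac hbc
  refine key (b - a) (c - b) (by simpa using hab) (by simpa using hbc) ?_
  rw [show b - a + (c - b) = c - a by abel]
  simpa using hac

/-- Reduction mod 3 is well defined on `ℤ / 27`, and no difference is divisible by 3. -/
theorem circulant27_colorable : circulant27.Colorable 3 := by
  have key : ∀ u v : Fin 27, (v - u = 1 ∨ v - u = 5 ∨ v - u = 8) ∨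
      (u - v = 1 ∨ u - v = 5 ∨ u - v = 8) → (u : ℕ) % 3 ≠ v % 3 := by
    decide +kernel
  refine ⟨SimpleGraph.Coloring.mk (fun u => ⟨(u : ℕ) % 3, Nat.mod_lt _ (by norm_num)⟩) ?_⟩
  intro u v huv h
  exact key u v (circulant27_adj.1 huv) (congrArg Fin.val h)

theorem eq_of_succ_eq {α : Type*} {g : Fin 27 → α} (h : ∀ u, g u = g (u + 1)) (u v : Fin 27) :
    g u = g v := by
  have key : ∀ u, g u = g 0 := by
    intro u
    induction u using Fin.induction with
    | zero => rfl
    | succ i ih => rw [← Fin.coeSucc_eq_succ, ← h, ih]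
  rw [key u, key v]

theorem circulant27_connected : circulant27.Connected where
  preconnected u v := by
    have h := eq_of_succ_eq (g := circulant27.connectedComponentMk)
      (fun u => SimpleGraph.ConnectedComponent.sound (circulant27_adj_add u).1.reachable) u v
    exact SimpleGraph.ConnectedComponent.exact h

/-- The steps `u → u + 1` form a Hamiltonian cycle. Since it never turns, its first step decides the
line containing the whole image; the column case follows by swapping coordinates. -/
theorem circulant27_rookRigid : RookRigid circulant27 := by
  intro h hh
  have step : ∀ (g : Fin 27 → ZMod 3 × ZMod 3), (∀ u v, circulant27.Adj u v →
      RookMove (g u) (g v)) → (g 0).1 = (g 1).1 → ∀ u v, (g u).1 = (g v).1 := by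
    intro g hg h₀
    have hsucc : ∀ u, (g u).1 = (g (u + 1)).1 → (g (u + 1)).1 = (g (u + 1 + 1)).1 := by
      intro u hu
      have := fst_eq_of_rookMove (a := fun i => g (u + Fin.ofNat 27 i)) (fun i => by
        have e : ∀ d, u + Fin.ofNat 27 (i + d) = u + Fin.ofNat 27 i + Fin.ofNat 27 d := by
          intro d
          rw [add_assoc]; congr 1
          ext; simp [Fin.val_add]
        simp only [e]
        have := circulant27_adj_add (u + Fin.ofNat 27 i)
        exact ⟨hg _ _ this.1, hg _ _ this.2.1, hg _ _ this.2.2⟩)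
      have e0 : u + Fin.ofNat 27 0 = u := add_zero u
      have e1 : u + Fin.ofNat 27 1 = u + 1 := rfl
      have e2 : u + Fin.ofNat 27 2 = u + 1 + 1 := by rw [add_assoc]; rfl
      simp only [e0, e1, e2] at this
      exact this hu
    have hall : ∀ u, (g u).1 = (g (u + 1)).1 := by
      intro u
      induction u using Fin.induction with
      | zero => exact h₀
      | succ i ih =>
        rw [← Fin.coeSucc_eq_succ]
        exact hsucc _ ih
    exact eq_of_succ_eq hall
  rcases hh 0 1 (circulant27_adj_add 0).1 with h₀ | h₀
  · exact .inl (step h hh h₀.1)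
  · exact .inr (step (fun u => (h u).swap) (fun u v huv => (hh u v huv).swap) h₀.2)

/-! ### Generic flows and equations of genus one -/

/-- The position of the corner of colour `i` in a model triangle. -/
def cornerPos (i : ZMod 3) : ℤ := i.val

/-- The displacement along an edge of the model triangle from colour `i` to colour `i + 1`. -/
def cornerStep (i : ZMod 3) : ℤ := cornerPos (i + 1) - cornerPos i

theorem cornerStep_cast (i : ZMod 3) : ((cornerStep i : ℤ) : ZMod 3) = 1 := by
  revert i; decide

theorem eq_add_one_or_of_ne {i j : ZMod 3} (h : i ≠ j) : j = i + 1 ∨ i = j + 1 := by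
  revert i j; decide

section Flow

variable {V : Type*} {H : SimpleGraph V} {φ : V → ZMod 3}

/-- The edges of `H`, oriented so that the colour `φ` increases by one. -/
abbrev OrientedEdge (H : SimpleGraph V) (φ : V → ZMod 3) : Type _ :=
  {e : V × V // H.Adj e.1 e.2 ∧ φ e.2 = φ e.1 + 1}

theorem exists_orientedEdge (hφ : ∀ u v, H.Adj u v → φ u ≠ φ v) {u v : V} (h : H.Adj u v) :
    ∃ e : OrientedEdge H φ, e.1 = (u, v) ∨ e.1 = (v, u) := by
  rcases eq_add_one_or_of_ne (hφ u v h) with h' | h'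
  · exact ⟨⟨(u, v), h, h'⟩, .inl rfl⟩
  · exact ⟨⟨(v, u), h.symm, h'⟩, .inr rfl⟩

/-- On a rigid graph, a potential whose increments along oriented edges are `0` or `cornerStep`
uses only one of the two options. -/
theorem RookRigid.potential_increments (hH : RookRigid H) (hφ : ∀ u v, H.Adj u v → φ u ≠ φ v)
    (T : Set (OrientedEdge H φ)) (p : V → ℚ)
    (hT : ∀ e ∈ T, p e.1.2 - p e.1.1 = cornerStep (φ e.1.1))
    (hT' : ∀ e ∉ T, p e.1.2 - p e.1.1 = 0) : T = ∅ ∨ T = Set.univ := by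
  -- The increments of `p` are integers, so taking floors preserves them and allows reduction mod 3,
  -- where every `cornerStep` is `1`.
  set q : V → ZMod 3 := fun v => ((⌊p v⌋ : ℤ) : ZMod 3) with hq
  have hqT : ∀ e ∈ T, q e.1.2 = q e.1.1 + 1 := by
    intro e he
    have h1 : p e.1.2 = p e.1.1 + (cornerStep (φ e.1.1) : ℤ) := by rw [← hT e he]; ring
    simp only [hq]
    rw [h1, Int.floor_add_intCast, Int.cast_add, cornerStep_cast]
  have hqT' : ∀ e ∉ T, q e.1.2 = q e.1.1 := by
    intro e he
    simp only [hq]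
    rw [sub_eq_zero.1 (hT' e he)]
  have hone : ∀ x : ZMod 3, x + 1 ≠ x := by decide
  -- Edges in `T` move only the first coordinate, the others only the second.
  have hmove : ∀ e : OrientedEdge H φ, RookMove (q e.1.1, q e.1.1 - φ e.1.1)
      (q e.1.2, q e.1.2 - φ e.1.2) := by
    intro e
    by_cases he : e ∈ T
    · right
      dsimp only
      rw [hqT e he, e.2.2]
      exact ⟨(hone _).symm, by ring⟩
    · left
      dsimp only
      rw [hqT' e he, e.2.2]
      refine ⟨rfl, fun h => hone (φ e.1.1) ?_⟩
      exact (sub_right_inj.1 h).symm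
  have hsymm : ∀ x y, RookMove x y → RookMove y x := by
    intro x y h
    unfold RookMove at *
    simpa only [eq_comm, ne_comm] using h
  rcases hH (fun v => (q v, q v - φ v)) (fun u v huv => by
    obtain ⟨e, he | he⟩ := exists_orientedEdge hφ huv
    · have := hmove e; rw [he] at this; exact this
    · have := hmove e; rw [he] at this; exact hsymm _ _ this) with h | h
  · left
    refine Set.eq_empty_iff_forall_notMem.2 fun e he => ?_
    have h1 := hqT e he
    have h2 : q e.1.1 = q e.1.2 := h _ _
    exact hone (q e.1.1) (by rw [← h1, h2])
  · right
    refine Set.eq_univ_iff_forall.2 fun e => ?_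
    by_contra he
    have h2 : q e.1.1 - φ e.1.1 = q e.1.2 - φ e.1.2 := h _ _
    rw [hqT' e he, e.2.2] at h2
    exact hone (φ e.1.1) (sub_right_inj.1 h2).symm

variable [Fintype V]

/-- A generic integral flow on a rigid graph: weighted by the displacements, no proper nonempty
set of edges has total weight zero. -/
theorem RookRigid.exists_flow [Fintype (OrientedEdge H φ)] (hH : RookRigid H) (hφ : ∀ u v, H.Adj u v → φ u ≠ φ v) :
    ∃ f : OrientedEdge H φ → ℤ,
      (∀ x : V → ℤ, ∑ e, f e * (x e.1.2 - x e.1.1) = 0) ∧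
      ∀ T : Finset (OrientedEdge H φ), T ≠ ∅ → T ≠ Finset.univ →
        ∑ e ∈ T, f e * cornerStep (φ e.1.1) ≠ 0 := by
  classical
  let d : (V → ℚ) →ₗ[ℚ] (OrientedEdge H φ → ℚ) :=
    { toFun := fun p e => p e.1.2 - p e.1.1
      map_add' := fun p q => by ext e; simp only [Pi.add_apply]; ring
      map_smul' := fun c p => by
        ext e; simp only [Pi.smul_apply, smul_eq_mul, RingHom.id_apply]; ring }
  let w : Finset (OrientedEdge H φ) → OrientedEdge H φ → ℚ :=
    fun T e => if e ∈ T then (cornerStep (φ e.1.1) : ℚ) else 0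
  -- A functional on the quotient by coboundaries is a flow. Each `w T` is nonzero there by
  -- rigidity, and over the infinite field `ℚ` one functional is nonzero on all of these finitely
  -- many vectors.
  obtain ⟨g, hg⟩ := Module.exists_dual_forall_apply_ne_zero (K := ℚ)
    (fun T : {T : Finset (OrientedEdge H φ) // T ≠ ∅ ∧ T ≠ Finset.univ} =>
      (LinearMap.range d).mkQ (w T.1)) (by
    rintro ⟨T, hT₀, hT₁⟩ h
    rw [Submodule.mkQ_apply, Submodule.Quotient.mk_eq_zero] at h
    obtain ⟨p, hp⟩ := h
    rcases hH.potential_increments hφ (T : Set (OrientedEdge H φ)) p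
      (fun e he => by
        have := congrFun hp e
        simpa [d, w, Finset.mem_coe.1 he] using this)
      (fun e he => by
        have := congrFun hp e
        rw [Finset.mem_coe] at he
        simpa [d, w, he] using this) with h | h
    · exact hT₀ (by simpa using h)
    · exact hT₁ (by simpa using h))
  let F : OrientedEdge H φ → ℚ := fun e => g ((LinearMap.range d).mkQ (Pi.single e 1))
  have hF : ∀ y : OrientedEdge H φ → ℚ, g ((LinearMap.range d).mkQ y) = ∑ e, F e * y e := by
    intro y
    have h := LinearMap.pi_apply_eq_sum_univ (g.comp (LinearMap.range d).mkQ) y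
    rw [LinearMap.comp_apply] at h
    rw [h]
    refine Finset.sum_congr rfl fun e _ => ?_
    rw [smul_eq_mul, mul_comm, LinearMap.comp_apply]
    congr 4
    ext j
    simp [Pi.single_apply, eq_comm]
  obtain ⟨D, hD⟩ := IsLocalization.exist_integer_multiples_of_finite (nonZeroDivisors ℤ) F
  choose f hf using hD
  have hf' : ∀ e, (f e : ℚ) = (D : ℤ) * F e := by
    intro e
    have := hf e
    simpa using this
  have hD0 : ((D : ℤ) : ℚ) ≠ 0 := by exact_mod_cast nonZeroDivisors.coe_ne_zero D
  refine ⟨f, fun x => ?_, fun T hT₀ hT₁ h => ?_⟩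
  · have h := hF (d fun v => x v)
    rw [Submodule.mkQ_apply, (Submodule.Quotient.mk_eq_zero _).2 (LinearMap.mem_range_self d _), map_zero] at h
    have : ((∑ e, f e * (x e.1.2 - x e.1.1) : ℤ) : ℚ) = (D : ℤ) * ∑ e, F e * d (fun v => x v) e := by
      push_cast
      rw [Finset.mul_sum]
      refine Finset.sum_congr rfl fun e _ => ?_
      rw [hf' e, mul_assoc]
      rfl
    rw [← h, mul_zero] at this
    exact_mod_cast this
  · refine hg ⟨T, hT₀, hT₁⟩ ?_
    rw [hF]
    have : ((∑ e ∈ T, f e * cornerStep (φ e.1.1) : ℤ) : ℚ) = (D : ℤ) * ∑ e, F e * w T e := by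
      push_cast
      simp only [w, mul_ite, mul_zero, Finset.sum_ite_mem, Finset.univ_inter]
      rw [Finset.mul_sum]
      refine Finset.sum_congr rfl fun e _ => ?_
      rw [hf' e, mul_assoc]
    rw [h, Int.cast_zero] at this
    exact (mul_eq_zero.1 this.symm).resolve_left hD0

/-- For a proper colouring `φ` of a rigid graph there is an equation of genus one such that, for
labels in a set avoiding it, all edges of a copy coloured by `φ` carry the same label. -/
theorem RookRigid.exists_isGenusOne (hH : RookRigid H) (hφ : ∀ u v, H.Adj u v → φ u ≠ φ v) :
    ∃ (k : ℕ) (a : Fin k → ℤ), IsGenusOne a ∧ ∀ R : Finset ℤ, AvoidsEquation a R →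
      ∀ x : V → ℤ,
        (∀ u v, H.Adj u v → φ v = φ u + 1 → ∃ r ∈ R, x v - x u = cornerStep (φ u) * r) →
        ∃ r, ∀ u v, H.Adj u v → φ v = φ u + 1 → x v - x u = cornerStep (φ u) * r := by
  classical
  obtain ⟨f, hf, hT⟩ := hH.exists_flow hφ
  let σ := (Fintype.equivFin (OrientedEdge H φ)).symm
  refine ⟨_, fun i => f (σ i) * cornerStep (φ (σ i).1.1), ⟨?_, fun T hT₀ hT₁ => ?_⟩, ?_⟩
  -- `cornerStep` is itself the coboundary of `cornerPos ∘ φ`, so the flow annihilates it.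
  · rw [Equiv.sum_comp σ fun e => f e * cornerStep (φ e.1.1), ← hf fun v => cornerPos (φ v)]
    refine Finset.sum_congr rfl fun e _ => ?_
    rw [e.2.2, cornerStep]
  · have h := hT (T.map σ.toEmbedding) (by simpa using hT₀) (by
      intro h
      apply hT₁
      rw [Finset.eq_univ_iff_forall] at h ⊢
      intro i
      simpa using h (σ i))
    rwa [Finset.sum_map] at h
  · intro R hR x hx
    choose r hrR hr using fun e : OrientedEdge H φ => hx e.1.1 e.1.2 e.2.1 e.2.2
    have hsol := hR (fun i => r (σ i)) fun i => hrR _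
    have hsum : ∑ i, f (σ i) * cornerStep (φ (σ i).1.1) * r (σ i) = 0 := by
      rw [Equiv.sum_comp σ fun e => f e * cornerStep (φ e.1.1) * r e, ← hf x]
      refine Finset.sum_congr rfl fun e _ => ?_
      rw [hr e, mul_assoc]
    have heq : ∀ e e', r e = r e' := by
      intro e e'
      by_contra hne
      exact hsol ⟨hsum, fun h => hne (by simpa using h (σ.symm e) (σ.symm e'))⟩
    by_cases hE : Nonempty (OrientedEdge H φ)
    · obtain ⟨e₀⟩ := hE
      refine ⟨r e₀, fun u v huv hc => ?_⟩
      rw [heq e₀ ⟨(u, v), huv, hc⟩]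
      exact hr ⟨(u, v), huv, hc⟩
    · exact ⟨0, fun u v huv hc => (hE ⟨⟨(u, v), huv, hc⟩⟩).elim⟩

end Flow

/-! ### Avoiding several equations at once -/

theorem AvoidsEquation.mono {k : ℕ} {a : Fin k → ℤ} {R S : Finset ℤ} (hS : AvoidsEquation a S)
    (h : R ⊆ S) : AvoidsEquation a R :=
  fun y hy => hS y fun i => h (hy i)

/-- As the coefficients sum to zero, solutions are translation invariant. -/
theorem AvoidsEquation.of_add_mem {k : ℕ} {a : Fin k → ℤ} (ha : ∑ i, a i = 0) {R S : Finset ℤ}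
    (hS : AvoidsEquation a S) (t : ℤ) (h : ∀ x ∈ R, x + t ∈ S) : AvoidsEquation a R := by
  intro y hy hsol
  refine hS (fun i => y i + t) (fun i => h _ (hy i)) ⟨?_, fun hall => hsol.2 fun i j => ?_⟩
  · simp only [mul_add, Finset.sum_add_distrib, ← Finset.sum_mul, ha, hsol.1]
    ring
  · exact add_right_cancel (hall i j)

theorem exists_avoidsEquation_card_eq {k : ℕ} (a : Fin k → ℤ) (m : ℕ) :
    ∃ R ⊆ Finset.Icc (1 : ℤ) m, AvoidsEquation a R ∧ R.card = maxAvoiding a m := by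
  classical
  have hempty : AvoidsEquation a ∅ := fun y hy hsol =>
    hsol.2 fun i => absurd (hy i) (by simp)
  have hne : ((Finset.Icc (1 : ℤ) (m : ℤ)).powerset.filter
      (fun R => AvoidsEquation a R)).Nonempty := ⟨∅, by simpa using hempty⟩
  obtain ⟨R, hR, h⟩ := Finset.exists_mem_eq_sup _ hne Finset.card
  rw [Finset.mem_filter, Finset.mem_powerset] at hR
  refine ⟨R, hR.1, hR.2, ?_⟩
  rw [maxAvoiding, ← h]

/-- Two subsets of `[m]` have translates with a large intersection. -/
theorem exists_translate_inter (m : ℕ) {R S : Finset ℤ} (hR : R ⊆ Finset.Icc (1 : ℤ) m)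
    (hS : S ⊆ Finset.Icc (1 : ℤ) m) :
    ∃ t : ℤ, ∃ Q ⊆ R, (∀ x ∈ Q, x + t ∈ S) ∧ R.card * S.card ≤ (2 * m + 1) * Q.card := by
  classical
  have hmaps : ∀ p ∈ R ×ˢ S, p.2 - p.1 ∈ Finset.Icc (-(m : ℤ)) m := by
    intro p hp
    rw [Finset.mem_product] at hp
    have h1 := Finset.mem_Icc.1 (hR hp.1)
    have h2 := Finset.mem_Icc.1 (hS hp.2)
    rw [Finset.mem_Icc]
    omega
  have hcard : (Finset.Icc (-(m : ℤ)) m).card = 2 * m + 1 := by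
    rw [Int.card_Icc]; omega
  have hne : (Finset.Icc (-(m : ℤ)) m).Nonempty := ⟨0, by simp⟩
  -- Pigeonhole: `t` is the most popular of the `2 * m + 1` possible differences.
  obtain ⟨t, -, ht⟩ := Finset.exists_max_image (Finset.Icc (-(m : ℤ)) m)
    (fun t => {p ∈ R ×ˢ S | p.2 - p.1 = t}.card) hne
  refine ⟨t, R.filter fun x => x + t ∈ S, Finset.filter_subset _ _,
    fun x hx => (Finset.mem_filter.1 hx).2, ?_⟩
  calc R.card * S.card = (R ×ˢ S).card := (Finset.card_product R S).symm
    _ = ∑ s ∈ Finset.Icc (-(m : ℤ)) m, {p ∈ R ×ˢ S | p.2 - p.1 = s}.card :=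
        Finset.card_eq_sum_card_fiberwise hmaps
    _ ≤ ∑ s ∈ Finset.Icc (-(m : ℤ)) m, {p ∈ R ×ˢ S | p.2 - p.1 = t}.card :=
        Finset.sum_le_sum ht
    _ = (2 * m + 1) * {p ∈ R ×ˢ S | p.2 - p.1 = t}.card := by
        rw [Finset.sum_const, hcard, smul_eq_mul]
    _ ≤ _ := by
        refine Nat.mul_le_mul_left _ (Finset.card_le_card_of_injOn Prod.fst ?_ ?_)
        · intro p hp
          simp only [Finset.coe_filter, Set.mem_ofPred_eq, Finset.mem_product] at hp ⊢
          refine ⟨hp.1.1, ?_⟩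
          rw [← hp.2, add_sub_cancel]
          exact hp.1.2
        · intro p hp q hq h
          simp only [Finset.coe_filter, Set.mem_ofPred_eq] at hp hq
          refine Prod.ext h ?_
          have := hp.2.trans hq.2.symm
          rw [h] at this
          exact sub_left_injective this

/-- Under Ruzsa's conjecture, finitely many equations of genus one can be avoided at once. -/
theorem RuzsaGenusConjecture.eventually_avoids (hRuzsa : RuzsaGenusConjecture) {ι : Type*}
    (s : Finset ι) (k : ι → ℕ) (a : ∀ j, Fin (k j) → ℤ) (ha : ∀ j, IsGenusOne (a j))
    {η : ℝ} (hη : 0 < η) :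
    ∀ᶠ m : ℕ in atTop, ∃ R ⊆ Finset.Icc (1 : ℤ) m, (∀ j ∈ s, AvoidsEquation (a j) R) ∧
      (m : ℝ) ^ (1 - η) ≤ R.card := by
  classical
  induction s using Finset.induction_on generalizing η with
  | empty =>
    filter_upwards [eventually_ge_atTop 1] with m hm
    refine ⟨Finset.Icc 1 m, subset_rfl, by simp, ?_⟩
    rw [Int.card_Icc, add_sub_cancel_right, Int.toNat_natCast]
    have h1 : (1 : ℝ) ≤ m := by exact_mod_cast hm
    calc (m : ℝ) ^ (1 - η) ≤ (m : ℝ) ^ (1 : ℝ) :=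
          Real.rpow_le_rpow_of_exponent_le h1 (by linarith)
      _ = m := Real.rpow_one _
  | insert j s _ ih =>
    -- Two sets of size `m ^ (1 - η / 3)` meet, after translation, in at least `m ^ (2 - 2 * η / 3)
    -- / (3 * m)` points; the spare `m ^ (η / 3)` absorbs the `3`.
    have hη3 : 0 < η / 3 := by positivity
    have hlarge : ∀ᶠ m : ℕ in atTop, (3 : ℝ) ≤ (m : ℝ) ^ (η / 3) :=
      ((tendsto_rpow_atTop hη3).comp tendsto_natCast_atTop_atTop).eventually_ge_atTop 3
    filter_upwards [ih hη3, hRuzsa _ (a j) (ha j) _ hη3, hlarge, eventually_ge_atTop 1]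
      with m ⟨R, hRm, hRa, hRc⟩ hj hm3 hm
    obtain ⟨S, hSm, hSa, hSc⟩ := exists_avoidsEquation_card_eq (a j) m
    obtain ⟨t, Q, hQR, hQS, hQ⟩ := exists_translate_inter m hRm hSm
    refine ⟨Q, hQR.trans hRm, ?_, ?_⟩
    · intro i hi
      rcases Finset.mem_insert.1 hi with rfl | hi
      · exact hSa.of_add_mem (ha i).1 t hQS
      · exact (hRa i hi).mono hQR
    · have hm0 : (0 : ℝ) < m := by exact_mod_cast hm
      have hm1 : (1 : ℝ) ≤ m := by exact_mod_cast hm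
      rw [← hSc] at hj
      have hQ' : (R.card : ℝ) * S.card ≤ (2 * m + 1) * Q.card := by exact_mod_cast hQ
      have h1 : (m : ℝ) ^ (1 - η / 3) * (m : ℝ) ^ (1 - η / 3) ≤ R.card * S.card := by
        gcongr
      have h2 : (m : ℝ) ^ (1 - η / 3) * (m : ℝ) ^ (1 - η / 3)
          = (m : ℝ) ^ (η / 3) * m * (m : ℝ) ^ (1 - η) := by
        nth_rewrite 4 [← Real.rpow_one (m : ℝ)]
        rw [← Real.rpow_add hm0, ← Real.rpow_add hm0, ← Real.rpow_add hm0]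
        ring_nf
      have h3 : 3 * (m : ℝ) * (m : ℝ) ^ (1 - η)
          ≤ (m : ℝ) ^ (η / 3) * m * (m : ℝ) ^ (1 - η) := by gcongr
      have h4 : (2 * (m : ℝ) + 1) * Q.card ≤ 3 * m * Q.card := by
        gcongr; linarith
      have h5 : 3 * (m : ℝ) * (m : ℝ) ^ (1 - η) ≤ 3 * m * Q.card := by linarith
      exact le_of_mul_le_mul_left h5 (by positivity)

/-! ### The blown-up Ruzsa–Szemerédi graph -/

section Construction

variable {n m : ℕ}

/-- The colour of the vertex `i`. -/
def vertexColor (i : Fin n) : ZMod 3 := ((i : ℕ) : ZMod 3)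

/-- The position of the vertex `i`: vertices come in blocks of length `9 * m`, with `3 * m`
positions of three colours in each block. -/
def vertexPos (m : ℕ) (i : Fin n) : ℤ := (((i : ℕ) % (9 * m) / 3 : ℕ) : ℤ)

/-- The blow-up of the Ruzsa–Szemerédi graph with labels in `R`. -/
def labelGraph (n m : ℕ) (R : Finset ℤ) : SimpleGraph (Fin n) :=
  SimpleGraph.fromRel fun i j => vertexColor j = vertexColor i + 1 ∧
    ∃ r ∈ R, vertexPos m j - vertexPos m i = cornerStep (vertexColor i) * r

variable {R : Finset ℤ}

theorem labelGraph_adj_of {i j : Fin n} (hc : vertexColor j = vertexColor i + 1) {r : ℤ}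
    (hr : r ∈ R) (h : vertexPos m j - vertexPos m i = cornerStep (vertexColor i) * r) :
    (labelGraph n m R).Adj i j := by
  rw [labelGraph, SimpleGraph.fromRel_adj]
  refine ⟨?_, .inl ⟨hc, r, hr, h⟩⟩
  rintro rfl
  exact absurd hc (by generalize vertexColor i = c; revert c; decide)

theorem labelGraph_adj_color_ne {i j : Fin n} (h : (labelGraph n m R).Adj i j) :
    vertexColor i ≠ vertexColor j := by
  rw [labelGraph, SimpleGraph.fromRel_adj] at h
  rcases h.2 with h | h
  all_goals
    rw [h.1]
    generalize vertexColor _ = c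
    revert c; decide

theorem labelGraph_adj_label {i j : Fin n} (h : (labelGraph n m R).Adj i j)
    (hc : vertexColor j = vertexColor i + 1) :
    ∃ r ∈ R, vertexPos m j - vertexPos m i = cornerStep (vertexColor i) * r := by
  rw [labelGraph, SimpleGraph.fromRel_adj] at h
  rcases h.2 with h | h
  · exact h.2
  · have h1 := h.1
    rw [hc] at h1
    exact absurd h1 (by generalize vertexColor i = c; revert c; decide)

theorem vertex_ext {i j : Fin n} (hc : vertexColor i = vertexColor j)
    (hp : vertexPos m i = vertexPos m j) (hd : (i : ℕ) / (9 * m) = (j : ℕ) / (9 * m)) :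
    i = j := by
  have hc' : (i : ℕ) % 3 = (j : ℕ) % 3 := (ZMod.natCast_eq_natCast_iff' _ _ 3).1 hc
  have hdvd : 3 ∣ 9 * m := ⟨3 * m, by ring⟩
  have hi := Nat.mod_mod_of_dvd (i : ℕ) hdvd
  have hj := Nat.mod_mod_of_dvd (j : ℕ) hdvd
  have hp' : (i : ℕ) % (9 * m) / 3 = (j : ℕ) % (9 * m) / 3 := Nat.cast_injective hp
  have hmod : (i : ℕ) % (9 * m) = (j : ℕ) % (9 * m) := by omega
  ext
  rw [← Nat.div_add_mod (i : ℕ) (9 * m), ← Nat.div_add_mod (j : ℕ) (9 * m), hd, hmod]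

/-! ### Counting copies -/

variable {V : Type*} {H : SimpleGraph V}

/-- Positions in a copy all of whose edges carry the same label form a multiple of the model
triangle. -/
theorem SimpleGraph.Connected.pos_eq_of_label (hH : H.Connected) {φ : V → ZMod 3}
    (hφ : ∀ u v, H.Adj u v → φ u ≠ φ v) {x : V → ℤ} {r : ℤ}
    (h : ∀ u v, H.Adj u v → φ v = φ u + 1 → x v - x u = cornerStep (φ u) * r) (u v : V) :
    x v - x u = (cornerPos (φ v) - cornerPos (φ u)) * r := by
  obtain ⟨p⟩ := hH.preconnected u v
  induction p with
  | nil => simp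
  | @cons a b c hab p ih =>
    have hstep : x b - x a = (cornerPos (φ b) - cornerPos (φ a)) * r := by
      rcases eq_add_one_or_of_ne (hφ a b hab) with hc | hc
      · rw [h a b hab hc, hc, cornerStep]
      · have := h b a hab.symm hc
        rw [cornerStep, ← hc] at this
        linear_combination -this
    linear_combination ih + hstep

theorem cornerPos_injective : Function.Injective cornerPos := by
  intro i j h
  revert h; revert i j; decide

variable [Fintype V]

/-- A rigid graph has few copies in a graph labelled by a set avoiding suitable equations. -/
theorem copyCount_labelGraph_le (hH : H.Connected) {u₀ v₀ : V} (h₀ : H.Adj u₀ v₀) (hm : 0 < m)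
    (hR : ∀ φ : V → ZMod 3, (∀ u v, H.Adj u v → φ u ≠ φ v) → ∀ x : V → ℤ,
      (∀ u v, H.Adj u v → φ v = φ u + 1 → ∃ r ∈ R, x v - x u = cornerStep (φ u) * r) →
      ∃ r, ∀ u v, H.Adj u v → φ v = φ u + 1 → x v - x u = cornerStep (φ u) * r) :
    (labelGraph n m R).copyCount H
      ≤ (9 * m) * ((9 * m) * (3 ^ Fintype.card V * (n / (9 * m) + 1) ^ Fintype.card V)) := by
  classical
  refine SimpleGraph.copyCount_le_labelledCopyCount.trans ?_
  rw [SimpleGraph.labelledCopyCount]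
  have hm9 : 0 < 9 * m := by omega
  -- A copy is encoded by two residues, which fix all positions, and the colour and block of each
  -- vertex. The extra block is the incomplete last one.
  let code : H.Copy (labelGraph n m R) →
      Fin (9 * m) × Fin (9 * m) × (V → ZMod 3) × (V → Fin (n / (9 * m) + 1)) := fun F =>
    (⟨(F u₀ : ℕ) % (9 * m), Nat.mod_lt _ hm9⟩, ⟨(F v₀ : ℕ) % (9 * m), Nat.mod_lt _ hm9⟩,
      fun v => vertexColor (F v),
      fun v => ⟨(F v : ℕ) / (9 * m), Nat.lt_succ_of_le (Nat.div_le_div_right (F v).2.le)⟩)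
  have hcode : Function.Injective code := by
    intro F F' h
    simp only [code, Prod.mk.injEq, Fin.mk.injEq] at h
    obtain ⟨hu, hv, hφ, hd⟩ := h
    have hpu : vertexPos m (F u₀) = vertexPos m (F' u₀) := by
      unfold vertexPos; rw [hu]
    have hpv : vertexPos m (F v₀) = vertexPos m (F' v₀) := by
      unfold vertexPos; rw [hv]
    have hadj : ∀ (F : H.Copy (labelGraph n m R)) (u v : V), H.Adj u v →
        (labelGraph n m R).Adj (F u) (F v) := fun F u v huv => F.toHom.map_adj huv
    have hlab : ∀ F : H.Copy (labelGraph n m R), ∃ r, ∀ u v,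
        vertexPos m (F v) - vertexPos m (F u)
          = (cornerPos (vertexColor (F v)) - cornerPos (vertexColor (F u))) * r := by
      intro F
      have hprop : ∀ u v, H.Adj u v → vertexColor (F u) ≠ vertexColor (F v) :=
        fun u v huv => labelGraph_adj_color_ne (hadj F u v huv)
      obtain ⟨r, hr⟩ := hR (fun v => vertexColor (F v)) hprop (fun v => vertexPos m (F v))
        fun u v huv hc => labelGraph_adj_label (hadj F u v huv) hc
      exact ⟨r, hH.pos_eq_of_label hprop hr⟩
    obtain ⟨r, hr⟩ := hlab F
    obtain ⟨r', hr'⟩ := hlab F'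
    have hφ' : ∀ v, vertexColor (F v) = vertexColor (F' v) := congrFun hφ
    -- Adjacent vertices have distinct corners, so their positions determine the label.
    have hrr : r = r' := by
      have h1 := hr u₀ v₀
      have h2 := hr' u₀ v₀
      rw [← hpu, ← hpv, ← hφ', ← hφ', h1] at h2
      refine mul_left_cancel₀ (sub_ne_zero.2 fun h => ?_) h2
      exact labelGraph_adj_color_ne (hadj F u₀ v₀ h₀) (cornerPos_injective h).symm
    refine DFunLike.ext _ _ fun v => vertex_ext (m := m) (hφ' v) ?_ ?_
    · have h1 := hr u₀ v
      have h2 := hr' u₀ v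
      rw [← hpu, ← hφ', ← hφ', ← hrr, ← h1] at h2
      exact (sub_left_inj.1 h2).symm
    · exact congrArg Fin.val (congrFun hd v)
  convert (Fintype.card_le_of_injective code hcode).trans (le_of_eq ?_)
  simp [ZMod.card]

/-! ### Disjoint triangles -/

/-- Position and block of the vertex in block `s` with position `x` and colour `c`. -/
theorem block_vertex {s x c : ℕ} (hx : x < 3 * m) (hc : c < 3) :
    (9 * m * s + 3 * x + c) % (9 * m) / 3 = x ∧ (9 * m * s + 3 * x + c) / (9 * m) = s := by
  have hlt : 3 * x + c < 9 * m := by omega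
  constructor
  · rw [add_assoc, Nat.mul_add_mod, Nat.mod_eq_of_lt hlt]; omega
  · rw [add_assoc, Nat.mul_add_div (by omega), Nat.div_eq_of_lt hlt, add_zero]

-- The triangles are indexed by a start `x < m`, a label `r ∈ R` and two blocks. Positions `x + c *
-- r` with `c ≤ 2` stay below `3 * m`.
open Classical in
theorem farFromTriangleFree_labelGraph (hR : R ⊆ Finset.Icc (1 : ℤ) m) {ε : ℝ}
    (hε : ε * ((n ^ 2 : ℕ) : ℝ) ≤ ((m * R.card * (n / (9 * m)) ^ 2 : ℕ) : ℝ)) :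
    (labelGraph n m R).FarFromTriangleFree ε := by
  classical
  set b := n / (9 * m) with hb
  have hbn : 9 * m * b ≤ n := Nat.mul_div_le n (9 * m)
  let I : Type := Fin m × R × Fin b × Fin b
  have hr : ∀ q : I, ∃ r : ℕ, (r : ℤ) = q.2.1 ∧ r ≤ m := by
    intro q
    have := Finset.mem_Icc.1 (hR q.2.1.2)
    exact ⟨(q.2.1 : ℤ).toNat, by omega, by omega⟩
  choose lab hlab hlabm using hr
  -- The blocks `s`, `t`, `s + t` mod `b` form a Latin square: any two determine the third, which
  -- makes the triangles edge-disjoint.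
  let blk : I → Fin 3 → ℕ := fun q =>
    ![(q.2.2.1 : ℕ), q.2.2.2, ((q.2.2.1 : ℕ) + q.2.2.2) % b]
  let num : I → Fin 3 → ℕ := fun q c => 9 * m * blk q c + 3 * (q.1 + c * lab q) + c
  have hxlt : ∀ (q : I) (c : Fin 3), (q.1 : ℕ) + c * lab q < 3 * m := by
    intro q c
    have h1 := q.1.2
    have h2 := hlabm q
    fin_cases c <;> simp <;> omega
  have hblk : ∀ q c, blk q c < b := by
    intro q c
    fin_cases c
    · exact q.2.2.1.2
    · exact q.2.2.2.2
    · exact Nat.mod_lt _ (Nat.pos_of_ne_zero fun h => by have := q.2.2.1.2; omega)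
  have hnum : ∀ q c, num q c < n := by
    intro q c
    have h1 := hxlt q c
    have h2 : 9 * m * (blk q c + 1) ≤ 9 * m * b := Nat.mul_le_mul_left _ (hblk q c)
    have h3 := c.2
    simp only [num]
    rw [mul_add] at h2
    omega
  let vert : I → Fin 3 → Fin n := fun q c => ⟨num q c, hnum q c⟩
  have hpos : ∀ q c, vertexPos m (vert q c) = ((q.1 + c * lab q : ℕ) : ℤ) := fun q c => by
    unfold vertexPos
    exact congrArg Nat.cast (block_vertex (hxlt q c) c.2).1
  have hcol : ∀ q c, vertexColor (vert q c) = ((c : ℕ) : ZMod 3) := by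
    intro q c
    refine (ZMod.natCast_eq_natCast_iff' _ _ 3).2 ?_
    have : num q c = 3 * (3 * m * blk q c + (q.1 + c * lab q)) + c := by simp only [num]; ring
    simp only [vert]
    rw [this, Nat.mul_add_mod]
  have hcinj : ∀ c c' : Fin 3, ((c : ℕ) : ZMod 3) = ((c' : ℕ) : ZMod 3) → c = c' := by decide
  have hdiv : ∀ q c, (vert q c : ℕ) / (9 * m) = blk q c := fun q c =>
    (block_vertex (hxlt q c) c.2).2
  have hvc : ∀ q q' c c', vert q c = vert q' c' → c = c' := fun q q' c c' h =>
    hcinj c c' (by rw [← hcol q, ← hcol q', h])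
  have hvinj : ∀ q q' c, vert q c = vert q' c →
      (q.1 : ℕ) + c * lab q = q'.1 + c * lab q' ∧ blk q c = blk q' c := by
    intro q q' c h
    refine ⟨?_, by rw [← hdiv, ← hdiv, h]⟩
    have := hpos q c
    rw [h, hpos] at this
    exact_mod_cast this.symm
  have hmod : ∀ s t t' : ℕ, t < b → t' < b → (s + t) % b = (s + t') % b → t = t' := by
    intro s t t' ht ht' h
    have := Nat.ModEq.add_left_cancel' s h
    rwa [Nat.ModEq, Nat.mod_eq_of_lt ht, Nat.mod_eq_of_lt ht'] at this
  have hdet : ∀ q q' c c', c ≠ c' → vert q c = vert q' c → vert q c' = vert q' c' → q = q' := by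
    intro q q' c c' hne h h'
    obtain ⟨hx, hs⟩ := hvinj _ _ _ h
    obtain ⟨hx', hs'⟩ := hvinj _ _ _ h'
    have hkey : (q.1 : ℕ) = q'.1 ∧ lab q = lab q' ∧ (q.2.2.1 : ℕ) = q'.2.2.1 ∧
        (q.2.2.2 : ℕ) = q'.2.2.2 := by
      have h0 : ∀ q, blk q 0 = q.2.2.1 := fun _ => rfl
      have h1 : ∀ q, blk q 1 = q.2.2.2 := fun _ => rfl
      have h2 : ∀ q, blk q 2 = ((q.2.2.1 : ℕ) + q.2.2.2) % b := fun _ => rfl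
      have hA : blk q 0 = blk q' 0 → blk q 2 = blk q' 2 → blk q 1 = blk q' 1 := by
        intro ha hc
        rw [h2, h2] at hc
        rw [h0, h0] at ha
        rw [ha] at hc
        exact hmod _ _ _ q.2.2.2.2 q'.2.2.2.2 hc
      have hB : blk q 1 = blk q' 1 → blk q 2 = blk q' 2 → blk q 0 = blk q' 0 := by
        intro ha hc
        rw [h2, h2] at hc
        rw [h1, h1] at ha
        rw [ha, add_comm, add_comm (q'.2.2.1 : ℕ)] at hc
        exact hmod _ _ _ q.2.2.1.2 q'.2.2.1.2 hc
      rw [← h0, ← h0, ← h1, ← h1]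
      fin_cases c <;> fin_cases c' <;> simp at hne hx hx' hs hs' <;>
        refine ⟨by omega, by omega, ?_, ?_⟩ <;>
        first | assumption | exact hA ‹_› ‹_› | exact hB ‹_› ‹_›
    obtain ⟨h1, h2, h3, h4⟩ := hkey
    refine Prod.ext (Fin.ext h1) (Prod.ext (Subtype.ext ?_) (Prod.ext (Fin.ext h3) (Fin.ext h4)))
    rw [← hlab q, ← hlab q', h2]
  let tri : I → Finset (Fin n) := fun q => Finset.univ.image (vert q)
  have htri : ∀ q q', (∃ u ∈ tri q, ∃ v ∈ tri q, u ∈ tri q' ∧ v ∈ tri q' ∧ u ≠ v) → q = q' := by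
    rintro q q' ⟨u, hu, v, hv, hu', hv', hne⟩
    simp only [tri, Finset.mem_image, Finset.mem_univ, true_and] at hu hv hu' hv'
    obtain ⟨c, rfl⟩ := hu
    obtain ⟨d, rfl⟩ := hv
    obtain ⟨c', hc'⟩ := hu'
    obtain ⟨d', hd'⟩ := hv'
    obtain rfl := hvc _ _ _ _ hc'
    obtain rfl := hvc _ _ _ _ hd'
    exact hdet q q' c' d' (fun h => hne (by rw [h])) hc'.symm hd'.symm
  have hvert : ∀ q, Function.Injective (vert q) := fun q c c' h => hvc q q c c' h
  have htinj : Function.Injective tri := by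
    intro q q' h
    have h0 : vert q 0 ∈ tri q := Finset.mem_image_of_mem _ (Finset.mem_univ _)
    have h1 : vert q 1 ∈ tri q := Finset.mem_image_of_mem _ (Finset.mem_univ _)
    exact htri q q' ⟨_, h0, _, h1, h ▸ h0, h ▸ h1, fun h => absurd (hvert q h) (by decide)⟩
  have hadj : ∀ q c c', c ≠ c' → (labelGraph n m R).Adj (vert q c) (vert q c') := by
    intro q
    have hsucc : ∀ c c' : Fin 3, ((c' : ℕ) : ZMod 3) = (c : ℕ) + 1 →
        (labelGraph n m R).Adj (vert q c) (vert q c') := by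
      intro c c' hcc
      refine labelGraph_adj_of (r := q.2.1) (by rw [hcol, hcol, hcc]) q.2.1.2 ?_
      have hstep : ∀ c c' : Fin 3, ((c' : ℕ) : ZMod 3) = (c : ℕ) + 1 →
          cornerStep ((c : ℕ) : ZMod 3) = (c' : ℤ) - (c : ℤ) := by decide
      rw [hpos, hpos, hcol, ← hlab q, hstep c c' hcc]
      push_cast
      ring
    intro c c' hne
    have hcases : ∀ c c' : Fin 3, c ≠ c' → ((c' : ℕ) : ZMod 3) = (c : ℕ) + 1 ∨
        ((c : ℕ) : ZMod 3) = (c' : ℕ) + 1 := by decide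
    rcases hcases c c' hne with h | h
    · exact hsucc c c' h
    · exact (hsucc c' c h).symm
  refine SimpleGraph.farFromTriangleFree_of_disjoint_triangles (Finset.univ.image tri) ?_ ?_ ?_
  · intro t ht
    obtain ⟨q, -, rfl⟩ := Finset.mem_image.1 ht
    rw [SimpleGraph.mem_cliqueFinset_iff, SimpleGraph.isNClique_iff]
    refine ⟨?_, by rw [Finset.card_image_of_injective _ (hvert q)]; rfl⟩
    intro u hu v hv hne
    simp only [tri, Finset.coe_image, Finset.coe_univ, Set.image_univ, Set.mem_range] at hu hv
    obtain ⟨c, rfl⟩ := hu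
    obtain ⟨c', rfl⟩ := hv
    exact hadj q c c' fun h => hne (by rw [h])
  · intro t ht t' ht' hne u hu v hv
    simp only [Finset.coe_image, Finset.coe_univ, Set.image_univ, Set.mem_range] at ht ht'
    obtain ⟨q, rfl⟩ := ht
    obtain ⟨q', rfl⟩ := ht'
    by_contra huv
    exact hne (by rw [htri q q' ⟨u, hu.1, v, hv.1, hu.2, hv.2, huv⟩])
  · rw [Finset.card_image_of_injective _ htinj, Finset.card_univ, Fintype.card_fin]
    refine hε.trans (le_of_eq ?_)
    simp only [I, Fintype.card_prod, Fintype.card_fin, Fintype.card_coe]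
    norm_cast
    ring

end Construction

/-! ### Choice of parameters -/

section Asymptotics

variable {V : Type*} [Fintype V] {H : SimpleGraph V}

/-- The count of copies in the blow-up, relative to `n ^ |V(H)|`. -/
theorem blowup_count_le {n m h : ℕ} (hm : 0 < m) (hn : 9 * m ≤ n) (hh : 3 ≤ h) :
    (((9 * m) * ((9 * m) * (3 ^ h * (n / (9 * m) + 1) ^ h)) : ℕ) : ℝ)
      ≤ 6 ^ h * (n : ℝ) ^ h / m := by
  have hm0 : (0 : ℝ) < m := by exact_mod_cast hm
  have hm1 : (1 : ℝ) ≤ m := by exact_mod_cast hm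
  have hn' : (9 * m : ℝ) ≤ n := by exact_mod_cast hn
  have hb : ((n / (9 * m) : ℕ) : ℝ) + 1 ≤ 2 * (n / (9 * m)) := by
    have h1 : ((n / (9 * m) : ℕ) : ℝ) ≤ (n : ℝ) / ((9 * m : ℕ) : ℝ) := Nat.cast_div_le
    push_cast at h1
    have h2 : (1 : ℝ) ≤ n / (9 * m) := by rwa [one_le_div (by positivity)]
    linarith
  obtain ⟨k, rfl⟩ := Nat.exists_eq_add_of_le' hh
  push_cast
  calc (9 * m : ℝ) * (9 * m * (3 ^ (k + 3) * (((n / (9 * m) : ℕ) : ℝ) + 1) ^ (k + 3)))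
      ≤ 9 * m * (9 * m * (3 ^ (k + 3) * (2 * (n / (9 * m))) ^ (k + 3))) := by gcongr
    _ = 6 ^ (k + 3) * (n : ℝ) ^ (k + 3) / (9 * m) * (1 / (9 * m) ^ k) := by
        rw [show (6 : ℝ) = 3 * 2 by norm_num]
        simp only [mul_pow, div_pow]
        field_simp
        ring
    _ ≤ 6 ^ (k + 3) * (n : ℝ) ^ (k + 3) / m * 1 := by
        gcongr
        · linarith
        · rw [div_le_one (by positivity)]
          exact one_le_pow₀ (by linarith)
    _ = _ := mul_one _

/-- With at least one full block, rounding costs at most a factor 2, so `n ≤ 18 * m * b` for `b = n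
/ (9 * m)`; and `324 = 18 ^ 2`. -/
theorem blowup_triangles_ge {n m c : ℕ} (hm : 0 < m) (hn : 9 * m ≤ n) {ε : ℝ}
    (hε : 324 * ε * m ≤ c) :
    ε * ((n ^ 2 : ℕ) : ℝ) ≤ ((m * c * (n / (9 * m)) ^ 2 : ℕ) : ℝ) := by
  have hm0 : (0 : ℝ) < m := by exact_mod_cast hm
  have hb : n ≤ 18 * m * (n / (9 * m)) := by
    have h1 := Nat.lt_div_mul_add (a := n) (b := 9 * m) (by omega)
    have h2 : 1 ≤ n / (9 * m) := (Nat.one_le_div_iff (by omega)).2 hn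
    nlinarith
  have hb' : (n : ℝ) ≤ 18 * m * ((n / (9 * m) : ℕ) : ℝ) := by exact_mod_cast hb
  push_cast
  set b : ℝ := ((n / (9 * m) : ℕ) : ℝ)
  rcases le_total ε 0 with h0 | h0
  · exact (mul_nonpos_of_nonpos_of_nonneg h0 (by positivity)).trans (by positivity)
  calc ε * (n : ℝ) ^ 2 ≤ ε * (18 * m * b) ^ 2 := by gcongr
    _ = m * (324 * ε * m) * b ^ 2 := by ring
    _ ≤ m * c * b ^ 2 := by gcongr

/-- A connected rigid graph on at least three vertices has few copies in suitable graphs far from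
triangle-free. -/
theorem RookRigid.hasSuperpolynomiallyFewCopies (hRuzsa : RuzsaGenusConjecture)
    (hH : RookRigid H) (hconn : H.Connected) {u₀ v₀ : V} (h₀ : H.Adj u₀ v₀)
    (hcard : 3 ≤ Fintype.card V) : HasSuperpolynomiallyFewCopies H := by
  classical
  intro C
  set K : ℝ := max C 1 with hK
  have hK1 : 1 ≤ K := le_max_right _ _
  have hK0 : 0 < K := by linarith
  set h := Fintype.card V
  set η : ℝ := 1 / (2 * K) with hη
  have hη0 : 0 < η := by positivity
  -- One equation for each of the finitely many proper colourings.
  choose k a ha hforce using fun φ : {φ : V → ZMod 3 // ∀ u v, H.Adj u v → φ u ≠ φ v} =>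
    hH.exists_isGenusOne φ.2
  have hR := hRuzsa.eventually_avoids Finset.univ k a ha hη0
  obtain ⟨m₀, hm₀⟩ := eventually_atTop.1 hR
  set A : ℝ := 2 * 6 ^ h * 324 ^ (2 * K) with hA
  have hA0 : 0 < A := by positivity
  have hzero : Tendsto (fun ε : ℝ => 324 * ε) (nhdsWithin 0 (Set.Ioi 0))
      (nhdsWithin 0 (Set.Ioi 0)) := by
    refine tendsto_nhdsWithin_iff.2 ⟨?_, ?_⟩
    · have : Tendsto (fun ε : ℝ => 324 * ε) (nhds 0) (nhds (324 * 0)) :=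
        (continuous_const.mul continuous_id).tendsto 0
      rw [mul_zero] at this
      exact this.mono_left nhdsWithin_le_nhds
    · filter_upwards [self_mem_nhdsWithin] with ε hε
      exact Set.mem_Ioi.2 (mul_pos (by norm_num) (Set.mem_Ioi.1 hε))
  have hX : Tendsto (fun ε : ℝ => ((324 * ε)⁻¹) ^ (2 * K)) (nhdsWithin 0 (Set.Ioi 0)) atTop :=
    (tendsto_rpow_atTop (by positivity)).comp (tendsto_inv_nhdsGT_zero.comp hzero)
  have hpow : Tendsto (fun ε : ℝ => A * ε ^ K) (nhds 0) (nhds 0) := by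
    have := ((Real.continuousAt_rpow_const 0 K (.inr hK0.le)).tendsto).const_mul A
    rwa [Real.zero_rpow hK0.ne', mul_zero] at this
  have hev : ∀ᶠ ε : ℝ in nhdsWithin 0 (Set.Ioi 0), max (m₀ : ℝ) 1 ≤ ((324 * ε)⁻¹) ^ (2 * K) ∧
      A * ε ^ K < 1 ∧ ε < 1 :=
    (hX.eventually_ge_atTop _).and (((hpow.mono_left nhdsWithin_le_nhds).eventually_lt_const
      one_pos).and (nhdsWithin_le_nhds (eventually_lt_nhds one_pos)))
  obtain ⟨ε₀, hε₀, hall⟩ := mem_nhdsGT_iff_exists_Ioo_subset.1 hev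
  refine ⟨ε₀, hε₀, fun ε hε hεlt => ?_⟩
  obtain ⟨hXε, hAε, hε1⟩ := hall ⟨hε, hεlt⟩
  -- As `η = 1 / (2 * K)`, this gives `m ^ η ≤ 1 / (324 * ε)`, the density needed, while `1 / m` has
  -- order `ε ^ (2 * K)`. One factor `ε ^ K` is spent on the constant `A`.
  set X : ℝ := ((324 * ε)⁻¹) ^ (2 * K) with hXdef
  have hX0 : 0 ≤ X := by positivity
  set m := ⌊X⌋₊ with hm
  have hmm₀ : m₀ ≤ m := Nat.le_floor ((le_max_left _ _).trans hXε)
  have hm1 : 1 ≤ m := Nat.le_floor (by push_cast; exact (le_max_right _ _).trans hXε)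
  have hm1' : (1 : ℝ) ≤ m := by exact_mod_cast hm1
  have hm0' : (0 : ℝ) < m := by linarith
  obtain ⟨R, hRm, hRa, hRc⟩ := hm₀ m hmm₀
  have hdense : 324 * ε * m ≤ R.card := by
    refine le_trans ?_ hRc
    have h1 : (m : ℝ) ^ η ≤ (324 * ε)⁻¹ := by
      calc (m : ℝ) ^ η ≤ X ^ η := by
            gcongr
            exact Nat.floor_le hX0
        _ = (324 * ε)⁻¹ := by
            rw [hXdef, ← Real.rpow_mul (by positivity), hη, mul_one_div_cancel (by positivity),
              Real.rpow_one]
    rw [Real.rpow_sub hm0', Real.rpow_one, le_div_iff₀ (by positivity)]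
    calc 324 * ε * m * (m : ℝ) ^ η ≤ 324 * ε * m * (324 * ε)⁻¹ := by gcongr
      _ = m := by field_simp
  refine ⟨9 * m, fun n hn => ⟨labelGraph n m R, ?_, ?_⟩⟩
  · exact farFromTriangleFree_labelGraph hRm (blowup_triangles_ge hm1 hn hdense)
  · have hcount := copyCount_labelGraph_le (n := n) (R := R) hconn h₀ hm1
      fun φ hφ => hforce ⟨φ, hφ⟩ R (hRa ⟨φ, hφ⟩ (Finset.mem_univ _))
    have hcount' : ((labelGraph n m R).copyCount H : ℝ) ≤ 6 ^ h * (n : ℝ) ^ h / m :=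
      le_trans (by exact_mod_cast hcount) (blowup_count_le hm1 hn hcard)
    have hinv : 1 / (m : ℝ) ≤ 2 * (324 * ε) ^ (2 * K) := by
      have hX2 : X ≤ 2 * m := by
        have := Nat.lt_floor_add_one X
        rw [← hm] at this
        linarith
      have hXinv : X = ((324 * ε) ^ (2 * K))⁻¹ := Real.inv_rpow (by positivity) _
      have hpos : 0 < (324 * ε) ^ (2 * K) := by positivity
      rw [hXinv, inv_le_iff_one_le_mul₀ hpos] at hX2
      rw [div_le_iff₀ hm0']
      linarith
    have hεK : ε ^ K ≤ ε ^ C := Real.rpow_le_rpow_of_exponent_ge hε hε1.le (le_max_left _ _)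
    calc ((labelGraph n m R).copyCount H : ℝ) ≤ 6 ^ h * (n : ℝ) ^ h * (1 / m) := by
          rw [mul_one_div]; exact hcount'
      _ ≤ 6 ^ h * (n : ℝ) ^ h * (2 * (324 * ε) ^ (2 * K)) := by gcongr
      _ = A * ε ^ K * ε ^ K * (n : ℝ) ^ h := by
          rw [Real.mul_rpow (by norm_num) hε.le, two_mul K, Real.rpow_add hε, ← two_mul K, hA]
          ring
      _ ≤ 1 * ε ^ C * (n : ℝ) ^ h := by gcongr
      _ = ε ^ C * (n : ℝ) ^ h := by rw [one_mul]

/-- The exponent `C + 1` beats an abundance exponent `C`, as `ε ^ C ≤ ε ^ C * ε` fails for `ε ≤ 1 /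
2`. -/
theorem HasSuperpolynomiallyFewCopies.not_isK3Abundant (hH : HasSuperpolynomiallyFewCopies H) :
    ¬ IsK3Abundant H := by
  rintro ⟨C, -, hC⟩
  obtain ⟨ε₀, hε₀, hfew⟩ := hH (C + 1)
  set ε := min (ε₀ / 2) (1 / 2) with hε
  have hε0 : 0 < ε := by positivity
  have hε2 : ε ≤ 1 / 2 := min_le_right _ _
  obtain ⟨n₁, h₁⟩ := hC ε hε0 hε2
  obtain ⟨n₂, h₂⟩ := hfew ε hε0 ((min_le_left _ _).trans_lt (half_lt_self hε₀))
  set n := max (max n₁ n₂) 1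
  obtain ⟨G, hfar, hG⟩ := h₂ n ((le_max_right _ _).trans (le_max_left _ _))
  have hn : (0 : ℝ) < (n : ℝ) ^ Fintype.card V :=
    pow_pos (Nat.cast_pos.2 (lt_of_lt_of_le one_pos (le_max_right _ _))) _
  have h := le_of_mul_le_mul_right
    ((h₁ n ((le_max_left _ _).trans (le_max_left _ _)) G hfar).trans hG) hn
  rw [Real.rpow_add hε0, Real.rpow_one] at h
  have hpos : 0 < ε ^ C := by positivity
  nlinarith

end Asymptotics

theorem theorem1p6 (hRuzsa : RuzsaGenusConjecture) :
    ∃ (v : ℕ) (H : SimpleGraph (Fin v)),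
      H.CliqueFree 3 ∧ H.Colorable 3 ∧ ¬ IsK3Abundant H ∧ HasSuperpolynomiallyFewCopies H := by
  have hfew : HasSuperpolynomiallyFewCopies circulant27 :=
    circulant27_rookRigid.hasSuperpolynomiallyFewCopies hRuzsa circulant27_connected
      (circulant27_adj_add 0).1 (by simp)
  exact ⟨27, circulant27, circulant27_cliqueFree, circulant27_colorable,
    hfew.not_isK3Abundant, hfew⟩
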